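/- Let $\varphi(x)=x^2-2$, and let $\varphi^{\circ n}$ denote its $n$-fold iterate ($\varphi^{\circ 0}(x)=x$, $\varphi^{\circ (n+1)}=\varphi\circ\varphi^{\circ n}$). Let $t_0\in\mathbb{Z}$ be congruent to $0$ or $1$ modulo $4$, and suppose that $t_0+2$ and $t_0-2$ are both square-free. For $n\ge 1$ put $\Phi_n(x,t_0)=\varphi^{\circ n}(x)-t_0\in\mathbb{Z}[x]$. Then for every $n\ge 1$ the polynomial $\Phi_n(x,t_0)$ is irreducible over $\mathbb{Q}$, so that $K_n=\mathbb{Q}[x]/(\Phi_n(x,t_0))$ is a number field; the discriminant of the number field $K_n$ equals the discriminant of the polynomial $\Phi_n(x,t_0)$, $$\operatorname{disc} K_n=\operatorname{disc}\Phi_n(x,t_0);$$ and, writing $\theta_n$ for the class of $x$ in $K_n$, the ring of integers of $K_n$ is $\mathbb{Z}[\theta_n]$. In particular $K_n$ is monogenic (monogène), i.e. its ring of integers is $\mathbb{Z}[\alpha]$ for some $\alpha \in K_n$. -/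

import Mathlib

open Polynomial

namespace StemField

/-- The polynomial `φ = x ^ 2 - 2`. -/
noncomputable def phi : ℤ[X] := X ^ 2 - 2

/-- The `n`-fold iterate of a polynomial: `iter f 0 = x` and `iter f (n + 1) = f (iter f n)`. -/
noncomputable def iter (f : ℤ[X]) : ℕ → ℤ[X]
  | 0 => X
  | n + 1 => f.comp (iter f n)

/-- `Φ_n(x, t₀) = φ^{∘n}(x) - t₀`, with integer coefficients. -/
noncomputable def Phi (n : ℕ) (t₀ : ℤ) : ℤ[X] := iter phi n - C t₀

/-- `Φ_n(x, t₀)` as a polynomial over `ℚ`. -/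
noncomputable def PhiQ (n : ℕ) (t₀ : ℤ) : ℚ[X] := (Phi n t₀).map (Int.castRingHom ℚ)

/-- The stem field `K_n = ℚ[x] / (Φ_n(x, t₀))`. -/
noncomputable abbrev K (n : ℕ) (t₀ : ℤ) : Type := AdjoinRoot (PhiQ n t₀)

/-- The class `θ_n` of `x` in `K_n`. -/
noncomputable def theta (n : ℕ) (t₀ : ℤ) : K n t₀ := AdjoinRoot.root (PhiQ n t₀)

/-- A number field is monogenic if its ring of integers is `ℤ[α]` for a single element `α`. -/
def IsMonogenic (L : Type*) [Field L] [NumberField L] : Prop :=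
  ∃ α : L, integralClosure ℤ L = Algebra.adjoin ℤ {α}

end StemField

namespace StemField

/-! Let `c` be 0 or 1 with `t₀ ≡ c` mod 4. Then `Φ_n ≡ (x - c)^(2^n)` mod 2 and `Φ_n(c) ≡ 2` mod 4,
so `Φ_n` is Eisenstein at 2 in `x - c`, hence irreducible.

It remains to see that `ℤ[θ]` is integrally closed, i.e. that each maximal ideal `P = (p, g(θ))` is
locally principal. If `Φ_n'(θ) ∉ P`, then `p` generates locally. Otherwise it suffices that `p` lies
locally in `P²`. Over 2 this is the Eisenstein relation. Over odd `p`, `Φ_n' = 2^n ∏_{i<n} φ^{∘i}`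
puts some `y = φ^{∘i}(θ)` in `P`; the critical orbit is `0 ↦ -2 ↦ 2 ↦ 2`, so `t₀ = φ^{∘(n-i)}(y) ≡
±2` mod `y²`. Thus `t₀ - 2` or `t₀ + 2` is in `P²`, and square-freeness yields `p`. -/

/-! ### A local criterion for `ℤ[θ]` to be integrally closed -/

theorem isIntegrallyClosed_localization_of_span_pair {R : Type*} [CommRing R] [IsDomain R]
    [IsNoetherianRing R] (P : Ideal R) [P.IsMaximal] {a b s : R} (hP : P = Ideal.span {a, b})
    (hs : s ∉ P) (h : s * a ∈ Ideal.span {b} ⊔ P ^ 2) :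
    IsIntegrallyClosed (Localization.AtPrime P) := by
  set A := Localization.AtPrime P
  have hmap : P.map (algebraMap R A) = IsLocalRing.maximalIdeal A :=
    IsLocalization.AtPrime.map_eq_maximalIdeal P A
  have hle : IsLocalRing.maximalIdeal A ≤ Ideal.span {algebraMap R A b} := by
    -- Nakayama: it is enough that `b` generates the maximal ideal modulo its square.
    apply Submodule.le_of_le_smul_of_le_jacobson_bot (I := IsLocalRing.maximalIdeal A)
      (IsNoetherian.noetherian _) (IsLocalRing.maximalIdeal_le_jacobson _)
    have hb : algebraMap R A b ∈ Ideal.span {algebraMap R A b} ⊔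
        IsLocalRing.maximalIdeal A • IsLocalRing.maximalIdeal A :=
      le_sup_left (α := Ideal A) (Ideal.mem_span_singleton_self _)
    have hu : IsUnit (algebraMap R A s) :=
      IsLocalization.map_units A (⟨s, hs⟩ : P.primeCompl)
    have ha : algebraMap R A a ∈ Ideal.span {algebraMap R A b} ⊔
        IsLocalRing.maximalIdeal A • IsLocalRing.maximalIdeal A := by
      have := Ideal.mem_map_of_mem (algebraMap R A) h
      rw [Ideal.map_sup, Ideal.map_span, Set.image_singleton, Ideal.map_pow, hmap, map_mul,
        Ideal.unit_mul_mem_iff_mem _ hu, pow_two] at this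
      exact this
    have hspan : P.map (algebraMap R A) = Ideal.span {algebraMap R A a, algebraMap R A b} := by
      rw [← Set.image_pair, ← Ideal.map_span]
      exact congrArg (Ideal.map (algebraMap R A)) hP
    rw [hmap] at hspan
    refine hspan.le.trans ?_
    rw [Ideal.span_le, Set.insert_subset_iff, Set.singleton_subset_iff]
    exact ⟨ha, hb⟩
  have hpr : (IsLocalRing.maximalIdeal A).IsPrincipal := by
    refine ⟨algebraMap R A b, le_antisymm hle ?_⟩
    have hbP : b ∈ P := hP.ge (Ideal.subset_span (by simp))
    rw [← Ideal.span, Ideal.span_singleton_le_iff_mem, ← hmap]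
    exact Ideal.mem_map_of_mem _ hbP
  have htfae := tfae_of_isNoetherianRing_of_isLocalRing_of_isDomain A
  exact ((htfae.out 4 3 :) |>.mp hpr).1

/-- `(ZMod p)[X]` is a principal ideal ring: `g` lifts a generator of the image of the preimage of
`P` in `ℤ[X]`. That preimage contains `f`, so `g` divides `f` mod `p`. -/
theorem exists_span_pair_and_eq_mul_add {R : Type*} [CommRing R] {θ : R}
    (hθ : Algebra.adjoin ℤ {θ} = ⊤) {f : ℤ[X]} (hf : aeval θ f = 0) {p : ℕ} (hp : p.Prime)
    (P : Ideal R) (hpP : (p : R) ∈ P) :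
    ∃ g h r : ℤ[X], P = Ideal.span {(p : R), aeval θ g} ∧ f = g * h + C (p : ℤ) * r := by
  have := Fact.mk hp
  have hsurj : Function.Surjective (aeval (R := ℤ) θ) := by
    rw [← AlgHom.range_eq_top, ← Algebra.adjoin_singleton_eq_range_aeval, hθ]
  set Q : Ideal ℤ[X] := P.comap (aeval (R := ℤ) θ) with hQ
  set π : ℤ[X] →+* (ZMod p)[X] := mapRingHom (Int.castRingHom (ZMod p)) with hπ
  have hπs : Function.Surjective π := map_surjective _ (ZMod.ringHom_surjective _)
  have hker {q : ℤ[X]} (hq : π q = 0) : ∃ r, q = C (p : ℤ) * r := by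
    have : C (p : ℤ) ∣ q := by
      rw [C_dvd_iff_dvd_coeff]
      intro i
      have h0 : (π q).coeff i = 0 := by rw [hq, coeff_zero]
      rw [hπ, coe_mapRingHom, coeff_map] at h0
      exact (ZMod.intCast_zmod_eq_zero_iff_dvd _ _).mp h0
    exact this
  obtain ⟨g', hg'⟩ := (IsPrincipalIdealRing.principal (Q.map π)).principal
  obtain ⟨g, rfl⟩ := hπs g'
  have hdiv {q : ℤ[X]} (hq : q ∈ Q) : ∃ h r : ℤ[X], q = g * h + C (p : ℤ) * r := by
    have h1 : π q ∈ Q.map π := Ideal.mem_map_of_mem _ hq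
    rw [hg', ← Ideal.span, Ideal.mem_span_singleton] at h1
    obtain ⟨h', hh⟩ := h1
    obtain ⟨h, rfl⟩ := hπs h'
    obtain ⟨r, hr⟩ := hker (q := q - g * h) (by rw [map_sub, map_mul, hh, sub_self])
    exact ⟨h, r, by rw [← hr]; ring⟩
  have hCQ (r : ℤ[X]) : C (p : ℤ) * r ∈ Q := by
    rw [hQ, Ideal.mem_comap, map_mul]
    simpa using P.mul_mem_right _ hpP
  have hgQ : g ∈ Q := by
    have h1 : π g ∈ Q.map π := by rw [hg']; exact Submodule.mem_span_singleton_self _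
    obtain ⟨q, hq, hqg⟩ := (Ideal.mem_map_iff_of_surjective π hπs).mp h1
    obtain ⟨r, hr⟩ := hker (q := g - q) (by rw [map_sub, hqg, sub_self])
    rw [← sub_add_cancel g q, hr]
    exact Q.add_mem (hCQ r) hq
  obtain ⟨h, r, hfe⟩ := hdiv (q := f) (by rw [hQ, Ideal.mem_comap, hf]; exact P.zero_mem)
  refine ⟨g, h, r, le_antisymm (fun x hx ↦ ?_) ?_, hfe⟩
  · obtain ⟨q, rfl⟩ := hsurj x
    obtain ⟨k, l, rfl⟩ := hdiv (q := q) hx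
    rw [Ideal.mem_span_pair]
    exact ⟨aeval θ l, aeval θ k, by simp; ring⟩
  · rw [Ideal.span_le, Set.insert_subset_iff, Set.singleton_subset_iff]
    exact ⟨hpP, hgQ⟩

theorem exists_prime_natCast_mem {R : Type*} [CommRing R] [Algebra.IsIntegral ℤ R]
    (P : Ideal R) [P.IsMaximal] : ∃ p : ℕ, p.Prime ∧ (p : R) ∈ P := by
  have hmax := Ideal.isMaximal_comap_of_isIntegral_of_isMaximal (R := ℤ) P
  set I := P.comap (algebraMap ℤ R) with hI
  have hne : I ≠ ⊥ := Ring.ne_bot_of_isMaximal_of_not_isField hmax Int.not_isField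
  have hpr := Submodule.IsPrincipal.prime_generator_of_isPrime I hne
  refine ⟨_, Int.prime_iff_natAbs_prime.mp hpr, ?_⟩
  have h1 : ((Submodule.IsPrincipal.generator I).natAbs : ℤ) ∈ I := by
    rw [Int.natCast_natAbs, abs_mem_iff]
    exact Submodule.IsPrincipal.generator_mem I
  rw [hI, Ideal.mem_comap, map_natCast] at h1
  exact h1

theorem isIntegrallyClosed_of_adjoin_eq_top {R : Type*} [CommRing R] [IsDomain R] {θ : R}
    (hθ : Algebra.adjoin ℤ {θ} = ⊤) {f : ℤ[X]} (hmonic : f.Monic) (hf : aeval θ f = 0)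
    (H : ∀ (P : Ideal R) [P.IsMaximal] (p : ℕ), p.Prime → (p : R) ∈ P →
      aeval θ (derivative f) ∈ P → ∃ s ∉ P, s * (p : R) ∈ P ^ 2) :
    IsIntegrallyClosed R := by
  have hint : IsIntegral ℤ θ := ⟨f, hmonic, hf⟩
  have hfin : Module.Finite ℤ R := by
    refine ⟨?_⟩
    have := hint.fg_adjoin_singleton
    rwa [hθ] at this
  have : IsNoetherianRing R := isNoetherian_of_tower ℤ inferInstance
  refine .of_localization_maximal fun P _ hPm ↦ ?_
  obtain ⟨p, hp, hpP⟩ := exists_prime_natCast_mem P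
  obtain ⟨g, h, r, hP, hfe⟩ := exists_span_pair_and_eq_mul_add hθ hf hp P hpP
  by_cases hder : aeval θ (derivative f) ∈ P
  · obtain ⟨s, hs, hsp⟩ := H P p hp hpP hder
    exact isIntegrallyClosed_localization_of_span_pair P hP hs
      (le_sup_right (α := Ideal R) hsp)
  -- Here `h(θ) ∉ P`, since otherwise `f' = g'h + gh' + pr'` would lie in `P` at `θ`. As `g(θ)h(θ) =
  -- -p r(θ)`, the element `p` generates `P` locally.
  · rw [Set.pair_comm] at hP
    have hg : aeval θ g ∈ P := by rw [hP]; exact Ideal.subset_span (by simp)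
    refine isIntegrallyClosed_localization_of_span_pair P (s := aeval θ h) hP (fun hh ↦ hder ?_)
      (le_sup_left (α := Ideal R) ?_)
    · rw [hfe]
      simp only [derivative_mul, derivative_C, map_add, map_mul, aeval_C,
        zero_mul, zero_add]
      refine P.add_mem (P.add_mem (P.mul_mem_left _ hh) (P.mul_mem_right _ hg))
        (P.mul_mem_right _ (by simpa using hpP))
    · have h0 : aeval θ g * aeval θ h + (p : R) * aeval θ r = 0 := by
        rw [hfe] at hf
        simpa using hf
      rw [Ideal.mem_span_singleton]
      exact ⟨-aeval θ r, by linear_combination h0⟩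

/-! ### Discriminants of fields and of polynomials -/

/-- Both sides equal, up to the same sign, the norm of `f'(θ)`, which is the product of `f'` over
the roots of `f`, i.e. the resultant of `f` and `f'`. -/
theorem discr_powerBasis_eq_discr_minpoly {K L : Type*} [Field K] [Field L] [Algebra K L]
    [Algebra.IsSeparable K L] (pb : PowerBasis K L) :
    Algebra.discr K pb.basis = (minpoly K pb.gen).discr := by
  classical
  have := pb.finite
  set E := AlgebraicClosure L
  set f := minpoly K pb.gen with hf
  have hmon : f.Monic := minpoly.monic pb.isIntegral_gen
  have hdeg : f.natDegree = pb.dim := pb.natDegree_minpoly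
  have hnorm : algebraMap K E (Algebra.norm K (aeval pb.gen (derivative f))) =
      ((f.map (algebraMap K E)).roots.map (derivative (f.map (algebraMap K E))).eval).prod := by
    rw [Algebra.norm_eq_prod_embeddings K E]
    have hnd : (f.map (algebraMap K E)).roots.Nodup :=
      nodup_roots (Separable.map (Algebra.IsSeparable.isSeparable K pb.gen))
    rw [Fintype.prod_equiv pb.liftEquiv' _
      (fun x ↦ (derivative (f.map (algebraMap K E))).eval (x : E))
      (fun σ ↦ by
        rw [PowerBasis.liftEquiv'_apply_coe, ← aeval_algHom_apply, derivative_map,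
          eval_map_algebraMap])]
    rw [Finset.prod_mem_multiset _ _ (derivative (f.map (algebraMap K E))).eval (fun _ ↦ rfl),
      Finset.prod, Multiset.toFinset_val, Multiset.dedup_eq_self.mpr hnd]
  have hres : f.resultant (derivative f) f.natDegree (f.natDegree - 1) =
      Algebra.norm K (aeval pb.gen (derivative f)) := by
    apply (algebraMap K E).injective
    have h := resultant_eq_prod_eval (f.map (algebraMap K E)) (derivative (f.map (algebraMap K E)))
      (f.natDegree - 1)
      ((natDegree_derivative_le _).trans (by rw [natDegree_map])) (IsAlgClosed.splits _)
    rw [(hmon.map _).leadingCoeff, one_pow, one_mul, natDegree_map, ← hnorm, derivative_map,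
      resultant_map_map] at h
    exact h
  have hpos : 0 < f.degree := minpoly.degree_pos pb.isIntegral_gen
  rw [Algebra.discr_powerBasis_eq_norm, ← hf, ← hres, resultant_deriv hpos, hmon.leadingCoeff,
    mul_one, hdeg, ← PowerBasis.finrank, ← mul_assoc, ← pow_add, ← two_mul, pow_mul]
  simp

theorem discr_map_of_monic {R S : Type*} [CommRing R] [CommRing S] [Nontrivial R] [Nontrivial S]
    (φ : R →+* S) {f : R[X]} (hf : f.Monic) (hdeg : 0 < f.natDegree) :
    (f.map φ).discr = φ f.discr := by
  have h1 := resultant_deriv (natDegree_pos_iff_degree_pos.mp hdeg)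
  have h2 := resultant_deriv (f := f.map φ)
    (natDegree_pos_iff_degree_pos.mp (by rwa [hf.natDegree_map]))
  rw [derivative_map, hf.natDegree_map, resultant_map_map, h1, hf.leadingCoeff,
    (hf.map φ).leadingCoeff] at h2
  simp only [mul_one, map_mul, map_pow, map_neg, map_one] at h2
  exact (((isUnit_one.neg).pow _).mul_left_cancel h2).symm

theorem isFractionRing_adjoin_singleton {L : Type*} [Field L] [Algebra ℚ L] {θ : L}
    (hθ : Algebra.adjoin ℚ {θ} = ⊤) : IsFractionRing (Algebra.adjoin ℤ {θ}) L := by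
  refine .of_field _ _ fun z ↦ ?_
  have hz : z ∈ Algebra.adjoin ℚ {θ} := hθ ▸ Algebra.mem_top
  rw [Algebra.adjoin_singleton_eq_range_aeval] at hz
  obtain ⟨q, rfl⟩ := hz
  obtain ⟨b, hbm, hb⟩ := IsLocalization.integerNormalization_spec (nonZeroDivisors ℤ) q
  have hb0 : (b : L) ≠ 0 := by
    have := algebraRat.charZero L
    exact_mod_cast nonZeroDivisors.ne_zero hbm
  refine ⟨⟨aeval θ (IsLocalization.integerNormalization (nonZeroDivisors ℤ) q),
    aeval_mem_adjoin_singleton _ _⟩, b, ?_⟩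
  have h := congrArg (aeval θ) hb
  rw [aeval_map_algebraMap] at h
  rw [map_intCast, eq_div_iff hb0]
  change _ = aeval θ _
  rw [h, map_zsmul, zsmul_eq_mul, mul_comm]
  rfl

theorem discr_eq_of_integralClosure_eq_adjoin {L : Type*} [Field L] [NumberField L] {θ : L}
    {f : ℤ[X]} (hf : f.Monic) (hmin : minpoly ℚ θ = f.map (Int.castRingHom ℚ))
    (hθ : Algebra.adjoin ℚ {θ} = ⊤) (hint : integralClosure ℤ L = Algebra.adjoin ℤ {θ}) :
    NumberField.discr L = f.discr := by
  have hθint : IsIntegral ℤ θ := by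
    have : θ ∈ integralClosure ℤ L := hint ▸ Algebra.self_mem_adjoin_singleton ℤ θ
    exact this
  have hdeg : 0 < f.natDegree := by
    rw [← hf.natDegree_map (Int.castRingHom ℚ), ← hmin]
    exact minpoly.natDegree_pos (hθint.tower_top)
  let pb := PowerBasis.ofAdjoinEqTop (hθint.tower_top (A := ℚ)) hθ
  let θ' : NumberField.RingOfIntegers L := ⟨θ, hθint⟩
  have hmap (q : ℤ[X]) : algebraMap (NumberField.RingOfIntegers L) L (aeval θ' q) = aeval θ q :=
    (aeval_algebraMap_apply L θ' q).symm
  have htop : Algebra.adjoin ℤ {θ'} = ⊤ := by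
    refine eq_top_iff.mpr fun x _ ↦ ?_
    have hx : (x : L) ∈ Algebra.adjoin ℤ {θ} := hint ▸ x.2
    rw [Algebra.adjoin_singleton_eq_range_aeval] at hx ⊢
    obtain ⟨q, hq⟩ := hx
    exact ⟨q, NumberField.RingOfIntegers.coe_injective ((hmap q).trans hq)⟩
  have hθint' : IsIntegral ℤ θ' := NumberField.RingOfIntegers.isIntegral θ'
  let pbZ := PowerBasis.ofAdjoinEqTop' hθint' htop
  have hgenZ : (pbZ.gen : L) = θ := by
    rw [PowerBasis.ofAdjoinEqTop'_gen]
    rfl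
  have hgen : pb.gen = θ := by simp [pb]
  -- The minimal polynomial over `ℚ` is the image of the one over `ℤ`, which is integrally closed.
  have hdim : pbZ.dim = pb.dim := by
    rw [← pb.natDegree_minpoly, hgen, minpoly.isIntegrallyClosed_eq_field_fractions' ℚ hθint,
      (minpoly.monic hθint).natDegree_map, PowerBasis.ofAdjoinEqTop'_dim]
    exact congrArg natDegree
      (minpoly.algebraMap_eq NumberField.RingOfIntegers.coe_injective θ').symm
  apply Int.cast_injective (α := ℚ)
  rw [← eq_intCast (Int.castRingHom ℚ) f.discr, ← discr_map_of_monic _ hf hdeg, ← hmin]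
  conv_rhs => rw [← hgen]
  rw [← discr_powerBasis_eq_discr_minpoly pb, ← NumberField.discr_eq_discr L pbZ.basis,
    ← eq_intCast (algebraMap ℤ ℚ),
    ← Algebra.discr_localizationLocalization ℤ (nonZeroDivisors ℤ) L,
    ← Algebra.discr_reindex ℚ _ (finCongr hdim)]
  congr 1
  ext i
  simp [hgenZ, hgen]
-- Iterates of `φ`, behaviour at 2 and irreducibility
theorem iter_phi_succ (n : ℕ) : iter phi (n + 1) = iter phi n ^ 2 - 2 := by
  simp [iter, phi]

theorem monic_iter_phi_and_natDegree (n : ℕ) :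
    (iter phi n).Monic ∧ (iter phi n).natDegree = 2 ^ n := by
  induction n with
  | zero => simp [iter, monic_X]
  | succ n ih =>
    obtain ⟨hm, hd⟩ := ih
    have hlt : (2 : ℤ[X]).degree < (iter phi n ^ 2).degree := by
      rw [degree_eq_natDegree (hm.pow 2).ne_zero, hm.natDegree_pow, hd]
      refine (degree_C_le (a := (2 : ℤ))).trans_lt ?_
      exact_mod_cast (by positivity : 0 < 2 * 2 ^ n)
    rw [iter_phi_succ]
    refine ⟨(hm.pow 2).sub_of_left hlt, ?_⟩
    rw [natDegree_sub_eq_left_of_natDegree_lt (natDegree_lt_natDegree (by norm_num) hlt),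
      hm.natDegree_pow, hd, pow_succ']

theorem natDegree_Phi (n : ℕ) (t₀ : ℤ) : (Phi n t₀).natDegree = 2 ^ n := by
  rw [Phi, natDegree_sub_C, (monic_iter_phi_and_natDegree n).2]

theorem monic_Phi (n : ℕ) (t₀ : ℤ) : (Phi n t₀).Monic := by
  obtain ⟨hm, hd⟩ := monic_iter_phi_and_natDegree n
  refine hm.sub_of_left (degree_C_le.trans_lt ?_)
  rw [degree_eq_natDegree hm.ne_zero, hd]
  exact_mod_cast (by positivity : 0 < 2 ^ n)

/-- Modulo 2, `φ` is squaring, which fixes `c`. The condition `c * c = c` treats `c = 0` and `c = 1`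
together. -/
theorem Phi_eq_pow_add_two_mul {t₀ c : ℤ} (hc : c * c = c) (ht : t₀ ≡ c [ZMOD 4]) (n : ℕ) :
    ∃ r : ℤ[X], Phi n t₀ = (X - C c) ^ 2 ^ n + C 2 * r := by
  have hiter : ∃ r : ℤ[X], iter phi n - C c = (X - C c) ^ 2 ^ n + C 2 * r := by
    induction n with
    | zero => exact ⟨0, by simp [iter]⟩
    | succ n ih =>
      obtain ⟨r, hr⟩ := ih
      have hcC : (C c : ℤ[X]) * C c = C c := by rw [← C_mul, hc]
      refine ⟨(X - C c) ^ 2 ^ n * (C c + 2 * r) + 2 * r * C c + 2 * r ^ 2 - 1, ?_⟩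
      rw [iter_phi_succ, pow_succ 2 n, pow_mul, sub_eq_iff_eq_add.mp hr]
      simp only [C_ofNat]
      linear_combination hcC
  obtain ⟨r, hr⟩ := hiter
  obtain ⟨k, hk⟩ := ht.dvd
  refine ⟨r + C (2 * k), ?_⟩
  have hk' : (C c : ℤ[X]) - C t₀ = C 2 * C (2 * k) := by
    rw [← C_sub, hk, ← C_mul]
    ring_nf
  rw [Phi]
  linear_combination hr + hk'

theorem eval_Phi_modEq_two {t₀ c : ℤ} (hc : c * c = c) (ht : t₀ ≡ c [ZMOD 4])
    {n : ℕ} (hn : 1 ≤ n) : (Phi n t₀).eval c ≡ 2 [ZMOD 4] := by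
  have hiter : (iter phi n).eval c ≡ c + 2 [ZMOD 4] := by
    induction n, hn using Nat.le_induction with
    | base =>
      rw [iter_phi_succ]
      simp only [iter, eval_sub, eval_pow, eval_X, eval_ofNat]
      exact (Int.modEq_iff_dvd).mpr ⟨1, by linear_combination -hc⟩
    | succ n hn ih =>
      rw [iter_phi_succ]
      simp only [eval_sub, eval_pow, eval_ofNat]
      refine ((ih.pow 2).sub_right 2).trans (Int.modEq_iff_dvd.mpr ⟨-c, ?_⟩)
      linear_combination -hc
  rw [Phi, eval_sub, eval_C]
  simpa using hiter.sub ht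

theorem irreducible_PhiQ {t₀ c : ℤ} (hc : c * c = c) (ht : t₀ ≡ c [ZMOD 4])
    {n : ℕ} (hn : 1 ≤ n) : Irreducible (PhiQ n t₀) := by
  have hmon := monic_Phi n t₀
  rw [PhiQ, ← algebraMap_int_eq, ← hmon.irreducible_iff_irreducible_map_fraction_map (K := ℚ)]
  have hdiv (a : ℤ) : Ideal.Quotient.mk (RingHom.ker (algebraMap ℤ (ZMod 2)) ^ 2) a = 0 ↔ 4 ∣ a := by
    rw [Ideal.Quotient.eq_zero_iff_mem, algebraMap_int_eq, ZMod.ker_intCastRingHom,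
      Ideal.span_singleton_pow, Ideal.mem_span_singleton]
    norm_num
  obtain ⟨r, hr⟩ := Phi_eq_pow_add_two_mul hc ht n
  refine generalizedEisenstein (K := ZMod 2) (q := X - C c) (p := 2 ^ n) ?_ (monic_X_sub_C c)
    hmon.isPrimitive (by rw [natDegree_Phi]; positivity) (by simp [hmon.leadingCoeff]) ?_ ?_
  · rw [Polynomial.map_sub, map_X, map_C]
    exact irreducible_X_sub_C _
  · have h2 : (2 : (ZMod 2)[X]) = 0 := by
      rw [← C_ofNat]
      exact C_eq_zero.mpr (by decide)
    rw [hmon.leadingCoeff, hr]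
    simp [h2]
  · rw [modByMonic_X_sub_C_eq_C_eval, map_C, Ne, C_eq_zero, hdiv]
    intro h
    have := (eval_Phi_modEq_two hc ht hn).dvd
    omega

/-! ### Maximal ideals containing the derivative -/

theorem iter_phi_map_add {R : Type*} [CommRing R] (θ : R) (i k : ℕ) :
    ∃ u, aeval θ (iter phi (i + k + 1)) = u * aeval θ (iter phi i) ^ 2 + 2 ∨
      aeval θ (iter phi (i + k + 1)) = u * aeval θ (iter phi i) ^ 2 - 2 := by
  induction k with
  | zero => exact ⟨1, Or.inr (by
    rw [add_zero, iter_phi_succ, map_sub, map_pow, map_ofNat, one_mul])⟩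
  | succ k ih =>
    obtain ⟨u, h | h⟩ := ih
    · refine ⟨u ^ 2 * aeval θ (iter phi i) ^ 2 + 4 * u, Or.inl ?_⟩
      rw [← add_assoc, iter_phi_succ]
      simp only [map_sub, map_pow, h, map_ofNat]
      ring
    · refine ⟨u ^ 2 * aeval θ (iter phi i) ^ 2 - 4 * u, Or.inl ?_⟩
      rw [← add_assoc, iter_phi_succ]
      simp only [map_sub, map_pow, h, map_ofNat]
      ring

theorem exists_iter_mem_of_derivative_mem {R : Type*} [CommRing R] (θ : R) (P : Ideal R)
    [P.IsPrime] (h2 : (2 : R) ∉ P) (n : ℕ) (h : aeval θ (derivative (iter phi n)) ∈ P) :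
    ∃ i < n, aeval θ (iter phi i) ∈ P := by
  induction n with
  | zero =>
    simp only [iter, derivative_X, map_one] at h
    exact absurd ((Ideal.eq_top_iff_one P).mpr h) (Ideal.IsPrime.ne_top ‹_›)
  | succ n ih =>
    have hder : derivative (iter phi (n + 1)) = 2 * iter phi n * derivative (iter phi n) := by
      rw [iter_phi_succ, derivative_sub, derivative_pow, ← C_ofNat, derivative_C]
      simp
    rw [hder, map_mul, map_mul, map_ofNat] at h
    rcases Ideal.IsPrime.mem_or_mem ‹_› h with h | h
    · exact ⟨n, n.lt_succ_self, (Ideal.IsPrime.mem_or_mem ‹_› h).resolve_left h2⟩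
    · obtain ⟨i, hi, hiP⟩ := ih h
      exact ⟨i, hi.trans n.lt_succ_self, hiP⟩

theorem intCast_mem_iff_of_prime_mem {R : Type*} [CommRing R] (P : Ideal R) (hP : P ≠ ⊤)
    {p : ℕ} (hp : p.Prime) (hpP : (p : R) ∈ P) (m : ℤ) : (m : R) ∈ P ↔ (p : ℤ) ∣ m := by
  refine ⟨fun hm ↦ ?_, ?_⟩
  · by_contra hd
    obtain ⟨a, b, hab⟩ := (Nat.prime_iff_prime_int.mp hp).irreducible.coprime_iff_not_dvd.mpr hd
    refine hP ((Ideal.eq_top_iff_one P).mpr ?_)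
    have h1 : (a : R) * p + b * m = 1 := by exact_mod_cast congrArg (Int.cast (R := R)) hab
    rw [← h1]
    exact P.add_mem (P.mul_mem_left _ hpP) (P.mul_mem_left _ hm)
  · rintro ⟨k, rfl⟩
    push_cast
    exact P.mul_mem_right _ hpP

theorem exists_mul_prime_mem_sq_of_squarefree {R : Type*} [CommRing R] (P : Ideal R) (hP : P ≠ ⊤)
    {p : ℕ} (hp : p.Prime) (hpP : (p : R) ∈ P) {m : ℤ} (hm : Squarefree m)
    (hmP : (m : R) ∈ P ^ 2) : ∃ s ∉ P, s * (p : R) ∈ P ^ 2 := by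
  obtain ⟨u, rfl⟩ := (intCast_mem_iff_of_prime_mem P hP hp hpP m).mp
    (Ideal.pow_le_self two_ne_zero hmP)
  refine ⟨(u : R), fun hu ↦ ?_, by rw [mul_comm]; exact_mod_cast hmP⟩
  rw [intCast_mem_iff_of_prime_mem P hP hp hpP] at hu
  have := hm p (mul_dvd_mul_left _ hu)
  exact (Nat.prime_iff_prime_int.mp hp).not_isUnit this

theorem exists_mul_two_mem_sq {R : Type*} [CommRing R] {θ : R} {t₀ c : ℤ} (hc : c * c = c)
    (ht : t₀ ≡ c [ZMOD 4]) {n : ℕ} (hn : 1 ≤ n) (hθ : aeval θ (Phi n t₀) = 0)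
    (P : Ideal R) [P.IsPrime] (h2 : (2 : R) ∈ P) : ∃ s ∉ P, s * (2 : R) ∈ P ^ 2 := by
  obtain ⟨r, hr⟩ := Phi_eq_pow_add_two_mul hc ht n
  have hrel : (θ - c) ^ 2 ^ n + 2 * aeval θ r = 0 := by
    rw [hr] at hθ
    simp only [map_add, map_mul, map_pow, map_sub, aeval_X, aeval_C] at hθ
    simpa using hθ
  have hmem : θ - c ∈ P := by
    refine Ideal.IsPrime.mem_of_pow_mem ‹_› (2 ^ n) ?_
    rw [eq_neg_of_add_eq_zero_left hrel]
    exact P.neg_mem (P.mul_mem_right _ h2)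
  -- Since `θ ≡ c` mod `P`, `r(θ) ∈ P` would make `r(c)` even, hence `4 ∣ Φ_n(c) = 2r(c)`.
  refine ⟨aeval θ r, fun hrP ↦ ?_, ?_⟩
  · have hev : ((r.eval c : ℤ) : R) ∈ P := by
      have hdvd : θ - c ∣ aeval θ r - aeval (c : R) r := by
        simpa [aeval_def, eval₂_eq_eval_map] using
          sub_dvd_eval_sub θ (c : R) (r.map (algebraMap ℤ R))
      have hcast : aeval (c : R) r = ((r.eval c : ℤ) : R) := by
        simpa using aeval_algebraMap_apply R c r
      rw [hcast] at hdvd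
      have := P.sub_mem hrP (P.mem_of_dvd hdvd hmem)
      rwa [sub_sub_cancel] at this
    rw [intCast_mem_iff_of_prime_mem P (Ideal.IsPrime.ne_top ‹_›) Nat.prime_two
      (by exact_mod_cast h2)] at hev
    have h4 := (eval_Phi_modEq_two hc ht hn).dvd
    rw [hr] at h4
    simp at h4
    omega
  · have : aeval θ r * 2 = -(θ - c) ^ 2 ^ n := by linear_combination hrel
    rw [this]
    refine (P ^ 2).neg_mem (Ideal.pow_le_pow_right ?_ (Ideal.pow_mem_pow hmem _))
    exact Nat.le_self_pow (by omega) 2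

theorem isIntegrallyClosed_adjoin {L : Type*} [Field L] {θ : L} {t₀ c : ℤ} (hc : c * c = c)
    (ht : t₀ ≡ c [ZMOD 4]) (hplus : Squarefree (t₀ + 2)) (hminus : Squarefree (t₀ - 2))
    {n : ℕ} (hn : 1 ≤ n) (hθ : aeval θ (Phi n t₀) = 0) :
    IsIntegrallyClosed (Algebra.adjoin ℤ {θ}) := by
  let θ' : Algebra.adjoin ℤ {θ} := ⟨θ, Algebra.self_mem_adjoin_singleton ℤ θ⟩
  have hroot : aeval θ' (Phi n t₀) = 0 := by
    apply Subtype.val_injective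
    rw [← Subalgebra.coe_val, ← aeval_algHom_apply]
    simpa [θ'] using hθ
  have htop : Algebra.adjoin ℤ {θ'} = ⊤ := by
    have := Algebra.adjoin_adjoin_coe_preimage (R := ℤ) (s := {θ})
    convert this using 2
    ext x
    simp [θ', Subtype.ext_iff]
  refine isIntegrallyClosed_of_adjoin_eq_top htop (monic_Phi n t₀) hroot
    fun P hP p hp hpP hder ↦ ?_
  by_cases h2 : (2 : Algebra.adjoin ℤ {θ}) ∈ P
  · have hp2 : p = 2 := by
      have := (intCast_mem_iff_of_prime_mem P hP.ne_top hp hpP 2).mp (by exact_mod_cast h2)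
      exact (Nat.prime_dvd_prime_iff_eq hp Nat.prime_two).mp (by exact_mod_cast this)
    subst hp2
    exact_mod_cast exists_mul_two_mem_sq hc ht hn hroot P h2
  · rw [Phi, derivative_sub, derivative_C, sub_zero] at hder
    obtain ⟨i, hi, hiP⟩ := exists_iter_mem_of_derivative_mem θ' P h2 n hder
    obtain ⟨k, rfl⟩ := Nat.exists_eq_add_of_lt hi
    have ht₀ : aeval θ' (iter phi (i + k + 1)) = (t₀ : Algebra.adjoin ℤ {θ}) := by
      rw [Phi, map_sub, aeval_C, sub_eq_zero] at hroot
      simpa using hroot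
    obtain ⟨u, h | h⟩ := iter_phi_map_add θ' i k <;> rw [ht₀] at h
    · refine exists_mul_prime_mem_sq_of_squarefree P hP.ne_top hp hpP hminus ?_
      push_cast
      rw [h, add_sub_cancel_right]
      exact (P ^ 2).mul_mem_left _ (Ideal.pow_mem_pow hiP 2)
    · refine exists_mul_prime_mem_sq_of_squarefree P hP.ne_top hp hpP hplus ?_
      push_cast
      rw [h, sub_add_cancel]
      exact (P ^ 2).mul_mem_left _ (Ideal.pow_mem_pow hiP 2)

theorem integralClosure_eq_adjoin_and_discr_eq {L : Type*} [Field L] [NumberField L] {θ : L}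
    {t₀ c : ℤ} (hc : c * c = c) (ht : t₀ ≡ c [ZMOD 4]) (hplus : Squarefree (t₀ + 2))
    (hminus : Squarefree (t₀ - 2)) {n : ℕ} (hn : 1 ≤ n) (hmin : minpoly ℚ θ = PhiQ n t₀)
    (htop : Algebra.adjoin ℚ {θ} = ⊤) :
    integralClosure ℤ L = Algebra.adjoin ℤ {θ} ∧ NumberField.discr L = (Phi n t₀).discr := by
  have hmon := monic_Phi n t₀
  have hθ : aeval θ (Phi n t₀) = 0 := by
    rw [← aeval_map_algebraMap ℚ, algebraMap_int_eq, ← PhiQ, ← hmin, minpoly.aeval]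
  have hclosed := isIntegrallyClosed_adjoin hc ht hplus hminus hn hθ
  have hfrac := isFractionRing_adjoin_singleton htop
  have hint : integralClosure ℤ L = Algebra.adjoin ℤ {θ} := by
    apply le_antisymm
    · intro x hx
      obtain ⟨y, rfl⟩ := (IsIntegrallyClosed.isIntegral_iff (R := Algebra.adjoin ℤ {θ})).mp
        (IsIntegral.tower_top hx)
      exact y.2
    · rw [Algebra.adjoin_le_iff, Set.singleton_subset_iff]
      exact ⟨_, hmon, hθ⟩
  exact ⟨hint, discr_eq_of_integralClosure_eq_adjoin hmon hmin htop hint⟩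

end StemField

theorem mainTheorem4 (t₀ : ℤ) (ht : t₀ ≡ 0 [ZMOD 4] ∨ t₀ ≡ 1 [ZMOD 4])
    (hplus : Squarefree (t₀ + 2)) (hminus : Squarefree (t₀ - 2)) (n : ℕ) (hn : 1 ≤ n) :
    ∃ hirr : Irreducible (StemField.PhiQ n t₀),
      haveI : Fact (Irreducible (StemField.PhiQ n t₀)) := ⟨hirr⟩
      NumberField.discr (StemField.K n t₀) = (StemField.Phi n t₀).discr ∧
      integralClosure ℤ (StemField.K n t₀) = Algebra.adjoin ℤ {StemField.theta n t₀} ∧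
      StemField.IsMonogenic (StemField.K n t₀) := by
  obtain ⟨c, hc, htc⟩ : ∃ c : ℤ, c * c = c ∧ t₀ ≡ c [ZMOD 4] := by
    rcases ht with ht | ht
    exacts [⟨0, by norm_num, ht⟩, ⟨1, by norm_num, ht⟩]
  have hirr := StemField.irreducible_PhiQ hc htc hn
  have : Fact (Irreducible (StemField.PhiQ n t₀)) := ⟨hirr⟩
  -- `K_n` carries two `ℚ`-algebra structures, from `AdjoinRoot` and from being a field of
  -- characteristic zero; they agree because ring maps out of `ℚ` are unique.
  have haeval (q : ℚ[X]) : @aeval ℚ (StemField.K n t₀) _ _ DivisionRing.toRatAlgebra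
      (StemField.theta n t₀) q = AdjoinRoot.mk (StemField.PhiQ n t₀) q := by
    rw [aeval_def, Subsingleton.elim (algebraMap ℚ (StemField.K n t₀))
      (AdjoinRoot.of (StemField.PhiQ n t₀))]
    exact AdjoinRoot.aeval_eq q
  have hmin := minpoly.eq_of_irreducible_of_monic hirr ((haeval _).trans AdjoinRoot.mk_self)
    ((StemField.monic_Phi n t₀).map _)
  obtain ⟨hint, hdiscr⟩ := StemField.integralClosure_eq_adjoin_and_discr_eq hc htc hplus hminus hn
    hmin.symm (by
      refine eq_top_iff.mpr fun x _ ↦ ?_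
      obtain ⟨q, rfl⟩ := AdjoinRoot.mk_surjective x
      rw [← haeval]
      exact aeval_mem_adjoin_singleton _ _)
  exact ⟨hirr, hdiscr, hint, _, hint⟩
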